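/- Let $k$ be a perfect field of characteristic $p>0$ and let $K/k$ be a field extension, with perfect closure $K^{\mathrm{perf}}$. Let $\mathcal D_\infty(K/k)$ be the category of triples $(V,W,\psi)$, where $V$ is a finite-dimensional $K$-vector space, $W$ is a finite-dimensional $k$-vector space and $\psi\colon K^{\mathrm{perf}}\otimes_K V\to K^{\mathrm{perf}}\otimes_k W$ is a $K^{\mathrm{perf}}$-linear isomorphism; a morphism $(V,W,\psi)\to(V',W',\psi')$ is a pair $(a,b)$ of a $K$-linear map $a\colon V\to V'$ and a $k$-linear map $b\colon W\to W'$ with $\psi'\circ(\mathrm{id}\otimes a)=(\mathrm{id}\otimes b)\circ\psi$. With the evident tensor product and the fibre functor $\omega(V,W,\psi)=W$ it is a neutral $k$-Tannakian category. The local Nori fundamental group $\pi^{\mathrm L}(K/k)$ is its Tannakian group scheme, i.e. the affine group scheme over $k$ whose group of $R$-points, for a commutative $k$-algebra $R$, is the group $\mathrm{Aut}^{\otimes}(R\otimes_k\omega)$ of tensor automorphisms of $X\mapsto R\otimes_k\omega(X)$. Then $K$ is perfect if and only if $\pi^{\mathrm L}(K/k)$ is trivial. -/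

import Mathlib

open CategoryTheory
open scoped TensorProduct

universe u v w

/-- For a `k`-algebra `K` of characteristic `p`, the perfect closure of `K` is a `k`-algebra through
`k → K → K^perf`. The case `k = K` is the canonical `K`-algebra structure. -/
noncomputable instance PerfectClosure.instAlgebraTower (k : Type u) (K : Type v) [Field k] [Field K]
    [Algebra k K] (p : ℕ) [Fact p.Prime] [CharP K p] : Algebra k (PerfectClosure K p) :=
  ((PerfectClosure.of K p).comp (algebraMap k K)).toAlgebra

/-- An object `(V, W, ψ)` of the category `𝒟_∞(K/k)`. -/
structure LocalTriple (k : Type u) (K : Type v) [Field k] [Field K] [Algebra k K]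
    (p : ℕ) [Fact p.Prime] [CharP K p] where
  V : Type v
  W : Type u
  [addCommGroupV : AddCommGroup V]
  [moduleV : Module K V]
  [finiteV : FiniteDimensional K V]
  [addCommGroupW : AddCommGroup W]
  [moduleW : Module k W]
  [finiteW : FiniteDimensional k W]
  ψ : (PerfectClosure K p ⊗[K] V) ≃ₗ[PerfectClosure K p] (PerfectClosure K p ⊗[k] W)

namespace LocalTriple

attribute [instance] addCommGroupV moduleV finiteV addCommGroupW moduleW finiteW

section

variable {k : Type u} {K : Type v} [Field k] [Field K] [Algebra k K]
  {p : ℕ} [Fact p.Prime] [CharP K p]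

/-- A morphism of `𝒟_∞(K/k)`: a pair of linear maps compatible with the isomorphisms `ψ`. -/
@[ext]
structure Hom (X Y : LocalTriple k K p) where
  a : X.V →ₗ[K] Y.V
  b : X.W →ₗ[k] Y.W
  comm : Y.ψ.toLinearMap ∘ₗ a.baseChange (PerfectClosure K p) =
    b.baseChange (PerfectClosure K p) ∘ₗ X.ψ.toLinearMap

/-- The category `𝒟_∞(K/k)`. -/
instance : Category (LocalTriple k K p) where
  Hom X Y := Hom X Y
  id X := ⟨LinearMap.id, LinearMap.id, by simp⟩
  comp f g := ⟨g.a ∘ₗ f.a, g.b ∘ₗ f.b, by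
    rw [LinearMap.baseChange_comp, LinearMap.baseChange_comp, ← LinearMap.comp_assoc, g.comm,
      LinearMap.comp_assoc, f.comm, LinearMap.comp_assoc]⟩

/-- The unit object `(K, k, id)`. -/
noncomputable def unit (k : Type u) (K : Type v) [Field k] [Field K] [Algebra k K]
    (p : ℕ) [Fact p.Prime] [CharP K p] : LocalTriple k K p where
  V := K
  W := k
  ψ := (TensorProduct.AlgebraTensorModule.rid K (PerfectClosure K p) (PerfectClosure K p)).trans
    (TensorProduct.AlgebraTensorModule.rid k (PerfectClosure K p) (PerfectClosure K p)).symm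

/-- The tensor product `(V ⊗ V', W ⊗ W', ψ ⊗ ψ')`. -/
noncomputable def tensor (X Y : LocalTriple k K p) : LocalTriple k K p where
  V := X.V ⊗[K] Y.V
  W := X.W ⊗[k] Y.W
  ψ := (TensorProduct.AlgebraTensorModule.distribBaseChange K (PerfectClosure K p) X.V Y.V).trans
    ((TensorProduct.congr X.ψ Y.ψ).trans
      (TensorProduct.AlgebraTensorModule.distribBaseChange k (PerfectClosure K p) X.W Y.W).symm)

end

end LocalTriple

section

variable {k : Type u} {R S T : Type w} [Field k] [CommRing R] [Algebra k R]
  [CommRing S] [Algebra k S] [CommRing T] [Algebra k T] {W : Type u} [AddCommGroup W] [Module k W]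

/-- The base change along `f : R → S` of an endomorphism `e` of `R ⊗ W`: the `S`-linear endomorphism
of `S ⊗ W` that sends `1 ⊗ w` to the image of `e (1 ⊗ w)`. -/
noncomputable def pushEnd (f : R →ₐ[k] S) (e : (R ⊗[k] W) →ₗ[R] (R ⊗[k] W)) :
    (S ⊗[k] W) →ₗ[S] (S ⊗[k] W) :=
  LinearMap.liftBaseChange S
    (f.toLinearMap.rTensor W ∘ₗ e.restrictScalars k ∘ₗ TensorProduct.mk k R W 1)

theorem rTensor_smul_alg (f : R →ₐ[k] S) (r : R) (x : R ⊗[k] W) :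
    f.toLinearMap.rTensor W (r • x) = f r • f.toLinearMap.rTensor W x := by
  induction x with
  | zero => simp
  | tmul a w => simp [TensorProduct.smul_tmul']
  | add x y hx hy => rw [smul_add, map_add, map_add, hx, hy, smul_add]

theorem pushEnd_rTensor (f : R →ₐ[k] S) (e : (R ⊗[k] W) →ₗ[R] (R ⊗[k] W)) (x : R ⊗[k] W) :
    pushEnd f e (f.toLinearMap.rTensor W x) = f.toLinearMap.rTensor W (e x) := by
  induction x with
  | zero => simp
  | tmul a w =>
    have h : a ⊗ₜ[k] w = a • ((1 : R) ⊗ₜ[k] w) := by simp [TensorProduct.smul_tmul']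
    rw [h, rTensor_smul_alg, LinearMap.map_smul, LinearMap.map_smul, rTensor_smul_alg]
    congr 1
    simp [pushEnd]
  | add x y hx hy => simp only [map_add, hx, hy]

theorem pushEnd_unique (f : R →ₐ[k] S) {M : Type*} [AddCommMonoid M] [Module S M]
    (g h : (S ⊗[k] W) →ₗ[S] M)
    (H : ∀ x, g (f.toLinearMap.rTensor W x) = h (f.toLinearMap.rTensor W x)) : g = h := by
  refine LinearMap.ext fun z => ?_
  induction z with
  | zero => simp
  | tmul s w =>
    have h1 : s ⊗ₜ[k] w = s • f.toLinearMap.rTensor W ((1 : R) ⊗ₜ[k] w) := by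
      simp [TensorProduct.smul_tmul']
    rw [h1, map_smul, map_smul, H]
  | add x y hx hy => rw [map_add, map_add, hx, hy]

theorem pushEnd_comp (f : R →ₐ[k] S) (e e' : (R ⊗[k] W) →ₗ[R] (R ⊗[k] W)) :
    pushEnd f (e ∘ₗ e') = pushEnd f e ∘ₗ pushEnd f e' :=
  pushEnd_unique f _ _ fun x => by simp [pushEnd_rTensor]

theorem pushEnd_id (f : R →ₐ[k] S) :
    pushEnd f (LinearMap.id : (R ⊗[k] W) →ₗ[R] (R ⊗[k] W)) = LinearMap.id :=
  pushEnd_unique f _ _ fun x => by simp [pushEnd_rTensor]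

/-- Base change of an automorphism of `R ⊗ W` along `f : R → S`. -/
noncomputable def pushAut (f : R →ₐ[k] S) (e : (R ⊗[k] W) ≃ₗ[R] (R ⊗[k] W)) :
    (S ⊗[k] W) ≃ₗ[S] (S ⊗[k] W) :=
  LinearEquiv.ofLinearMap (pushEnd f e.toLinearMap) (pushEnd f e.symm.toLinearMap)
    (by rw [← pushEnd_comp, LinearEquiv.comp_symm, pushEnd_id])
    (by rw [← pushEnd_comp, LinearEquiv.symm_comp, pushEnd_id])

theorem pushAut_rTensor (f : R →ₐ[k] S) (e : (R ⊗[k] W) ≃ₗ[R] (R ⊗[k] W)) (x : R ⊗[k] W) :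
    pushAut f e (f.toLinearMap.rTensor W x) = f.toLinearMap.rTensor W (e x) :=
  pushEnd_rTensor f e.toLinearMap x

theorem pushAut_unique (f : R →ₐ[k] S) (g h : (S ⊗[k] W) ≃ₗ[S] (S ⊗[k] W))
    (H : ∀ x, g (f.toLinearMap.rTensor W x) = h (f.toLinearMap.rTensor W x)) : g = h :=
  LinearEquiv.toLinearMap_injective (pushEnd_unique f _ _ H)

theorem pushAut_idHom (e : (R ⊗[k] W) ≃ₗ[R] (R ⊗[k] W)) : pushAut (AlgHom.id k R) e = e := by
  refine pushAut_unique (AlgHom.id k R) _ _ fun y => ?_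
  have h : ∀ x : R ⊗[k] W, (AlgHom.id k R).toLinearMap.rTensor W x = x := fun x => by simp
  rw [pushAut_rTensor, h, h]

theorem pushAut_compHom (f : R →ₐ[k] S) (g : S →ₐ[k] T) (e : (R ⊗[k] W) ≃ₗ[R] (R ⊗[k] W)) :
    pushAut (g.comp f) e = pushAut g (pushAut f e) := by
  refine pushAut_unique (g.comp f) _ _ fun y => ?_
  have h : ∀ x : R ⊗[k] W, (g.comp f).toLinearMap.rTensor W x =
      g.toLinearMap.rTensor W (f.toLinearMap.rTensor W x) := fun x => by
    rw [← LinearMap.rTensor_comp_apply]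
    rfl
  rw [pushAut_rTensor, h, h, pushAut_rTensor, pushAut_rTensor]

end

section

variable {k : Type u} {R S : Type w} [Field k] [CommRing R] [Algebra k R]
  [CommRing S] [Algebra k S] {W W' : Type u} [AddCommGroup W] [Module k W]
  [AddCommGroup W'] [Module k W']

theorem rTensor_baseChange (f : R →ₐ[k] S) (b : W →ₗ[k] W') (x : R ⊗[k] W) :
    f.toLinearMap.rTensor W' (b.baseChange R x) = b.baseChange S (f.toLinearMap.rTensor W x) := by
  induction x with
  | zero => simp
  | tmul a w => simp
  | add x y hx hy => simp only [map_add, hx, hy]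

theorem rTensor_distrib_symm (f : R →ₐ[k] S) (x : R ⊗[k] W) (y : R ⊗[k] W') :
    f.toLinearMap.rTensor (W ⊗[k] W')
        ((TensorProduct.AlgebraTensorModule.distribBaseChange k R W W').symm (x ⊗ₜ[R] y)) =
      (TensorProduct.AlgebraTensorModule.distribBaseChange k S W W').symm
        (f.toLinearMap.rTensor W x ⊗ₜ[S] f.toLinearMap.rTensor W' y) := by
  induction x with
  | zero => simp
  | add x x' hx hx' => simp only [TensorProduct.add_tmul, map_add, hx, hx']
  | tmul a w =>
    induction y with
    | zero => simp
    | add y y' hy hy' => simp only [TensorProduct.tmul_add, map_add, hy, hy']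
    | tmul b w' =>
      simp [TensorProduct.AlgebraTensorModule.distribBaseChange, TensorProduct.smul_tmul']

theorem congr_pushAut (f : R →ₐ[k] S) (e : (R ⊗[k] W) ≃ₗ[R] (R ⊗[k] W))
    (e' : (R ⊗[k] W') ≃ₗ[R] (R ⊗[k] W'))
    (E : (R ⊗[k] (W ⊗[k] W')) ≃ₗ[R] (R ⊗[k] (W ⊗[k] W')))
    (h : ∀ z, TensorProduct.AlgebraTensorModule.distribBaseChange k R W W' (E z) =
      TensorProduct.congr e e' (TensorProduct.AlgebraTensorModule.distribBaseChange k R W W' z))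
    (z : S ⊗[k] (W ⊗[k] W')) :
    TensorProduct.AlgebraTensorModule.distribBaseChange k S W W' (pushAut f E z) =
      TensorProduct.congr (pushAut f e) (pushAut f e')
        (TensorProduct.AlgebraTensorModule.distribBaseChange k S W W' z) := by
  set DR := TensorProduct.AlgebraTensorModule.distribBaseChange k R W W'
  set DS := TensorProduct.AlgebraTensorModule.distribBaseChange k S W W'
  have key : DS.toLinearMap ∘ₗ (pushAut f E).toLinearMap =
      (TensorProduct.congr (pushAut f e) (pushAut f e')).toLinearMap ∘ₗ DS.toLinearMap := by
    apply pushEnd_unique f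
    intro x
    obtain ⟨t, rfl⟩ := DR.symm.surjective x
    simp only [LinearMap.comp_apply, LinearEquiv.coe_coe, pushAut_rTensor]
    have hE : E (DR.symm t) = DR.symm (TensorProduct.congr e e' t) := by
      apply DR.injective
      rw [h, DR.apply_symm_apply, DR.apply_symm_apply]
    rw [hE]
    clear hE
    induction t with
    | zero => simp
    | add t t' ht ht' => simp only [map_add, ht, ht']
    | tmul x y =>
      rw [TensorProduct.congr_tmul, rTensor_distrib_symm, rTensor_distrib_symm,
        LinearEquiv.apply_symm_apply, LinearEquiv.apply_symm_apply, TensorProduct.congr_tmul,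
        pushAut_rTensor, pushAut_rTensor]
  exact LinearMap.congr_fun key z

end

/-- `π^L(K/k)(R) = Aut^⊗(ω ⊗ R)`: the group of families `λ_X` of `R`-linear automorphisms of
`R ⊗ ω(X)`, where `ω(V, W, ψ) = W`, that are natural in `X`, compatible with tensor products and
the identity on the unit object. -/
noncomputable def localNoriPoints (k : Type u) (K : Type v) [Field k] [Field K] [Algebra k K]
    (p : ℕ) [Fact p.Prime] [CharP K p] (R : Type w) [CommRing R] [Algebra k R] :
    Subgroup (∀ X : LocalTriple k K p, (R ⊗[k] X.W) ≃ₗ[R] (R ⊗[k] X.W)) where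
  carrier := {l |
    (∀ (X Y : LocalTriple k K p) (f : X ⟶ Y) (x : R ⊗[k] X.W),
      f.b.baseChange R (l X x) = l Y (f.b.baseChange R x)) ∧
    (∀ (X Y : LocalTriple k K p) (z : R ⊗[k] (X.W ⊗[k] Y.W)),
      TensorProduct.AlgebraTensorModule.distribBaseChange k R X.W Y.W (l (X.tensor Y) z) =
        TensorProduct.congr (l X) (l Y)
          (TensorProduct.AlgebraTensorModule.distribBaseChange k R X.W Y.W z)) ∧
    l (LocalTriple.unit k K p) = 1}
  mul_mem' := by
    rintro a b ⟨ha, ha', ha''⟩ ⟨hb, hb', hb''⟩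
    refine ⟨fun X Y f x => ?_, fun X Y z => ?_, ?_⟩
    · simp only [Pi.mul_apply, LinearEquiv.mul_apply, ha, hb]
    · refine (ha' X Y (b (X.tensor Y) z)).trans ?_
      rw [hb', Pi.mul_apply, Pi.mul_apply, LinearEquiv.mul_eq_trans, LinearEquiv.mul_eq_trans,
        TensorProduct.congr_trans]
      rfl
    · rw [Pi.mul_apply, ha'', hb'', mul_one]
  one_mem' := by
    refine ⟨fun X Y f x => rfl, fun X Y z => ?_, rfl⟩
    simp only [Pi.one_apply, LinearEquiv.one_eq_refl, TensorProduct.congr_refl_refl]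
    rfl
  inv_mem' := by
    rintro a ⟨ha, ha', ha''⟩
    refine ⟨fun X Y f x => ?_, fun X Y z => ?_, ?_⟩
    · apply (a Y).injective
      rw [← ha]
      exact (congrArg _ ((a X).apply_symm_apply x)).trans ((a Y).apply_symm_apply _).symm
    · apply (TensorProduct.congr (a X) (a Y)).injective
      refine (ha' X Y _).symm.trans ?_
      refine (congrArg _ ((a (X.tensor Y)).apply_symm_apply z)).trans ?_
      exact ((TensorProduct.congr (a X) (a Y)).apply_symm_apply _).symm
    · rw [Pi.inv_apply, ha'', inv_one]

/-- The local Nori fundamental group `π^L(K/k)`, the Tannakian group scheme of `𝒟_∞(K/k)` with the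
fibre functor `ω(V, W, ψ) = W`, given by its functor of points `R ↦ Aut^⊗(ω ⊗ R)` on
`k`-algebras. -/
noncomputable def localNoriGroup (k : Type u) (K : Type v) [Field k] [Field K] [Algebra k K]
    (p : ℕ) [Fact p.Prime] [CharP K p] :
    CommAlgCat.{max u v} k ⥤ GrpCat.{max (u + 1) (v + 1)} where
  obj R := GrpCat.of (localNoriPoints k K p R)
  map {R S} f := GrpCat.ofHom
    { toFun := fun l => ⟨fun X => pushAut f.hom (l.1 X), by
        obtain ⟨l, h, h', h''⟩ := l
        refine ⟨fun X Y g x => ?_, fun X Y z => ?_, ?_⟩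
        · refine LinearMap.congr_fun (pushEnd_unique f.hom
            (g.b.baseChange S ∘ₗ (pushAut f.hom (l X)).toLinearMap)
            ((pushAut f.hom (l Y)).toLinearMap ∘ₗ g.b.baseChange S) fun y => ?_) x
          simp only [LinearMap.comp_apply, LinearEquiv.coe_coe, pushAut_rTensor,
            ← rTensor_baseChange, h]
        · exact congr_pushAut f.hom (l X) (l Y) (l (X.tensor Y)) (h' X Y) z
        · refine pushAut_unique f.hom _ _ fun y => ?_
          simp only [pushAut_rTensor, h'']
          rfl⟩
      map_one' := Subtype.ext <| funext fun X => pushAut_unique f.hom _ _ fun y => by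
        rw [pushAut_rTensor]
        rfl
      map_mul' := fun a b => Subtype.ext <| funext fun X => pushAut_unique f.hom _ _ fun y => by
        rw [pushAut_rTensor]
        refine Eq.trans ?_ (congrArg _ (pushAut_rTensor f.hom (b.1 X) y)).symm
        exact (pushAut_rTensor f.hom (a.1 X) (b.1 X y)).symm }
  map_id R := GrpCat.hom_ext <| MonoidHom.ext fun l => Subtype.ext <| funext fun X =>
    pushAut_idHom (l.1 X)
  map_comp f g := GrpCat.hom_ext <| MonoidHom.ext fun l => Subtype.ext <| funext fun X =>
    pushAut_compHom f.hom g.hom (l.1 X)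

/-! ### Base change of the isomorphisms `ψ` along maps out of `K^perf`. -/

section

open TensorProduct

variable {k K E R : Type*} [CommRing k] [CommRing K] [CommRing E] [CommRing R]
  [Algebra k E] [Algebra k R] [Algebra K E] [Algebra K R]
  {V V' W W' : Type*} [AddCommGroup V] [Module K V] [AddCommGroup V'] [Module K V']
  [AddCommGroup W] [Module k W] [AddCommGroup W'] [Module k W']

/-! Write `E` for `K^perf`. If `K` is perfect, then `K → E` is onto, so for every `w` in `W` the
element `ψ⁻¹(1 ⊗ w)` has the form `1 ⊗ v`, and `(v, w)` is a morphism from the unit object. A tensor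
automorphism is the identity on the unit, hence by naturality it fixes each `1 ⊗ w` and is trivial
(`localNoriPoints_eq_one_of_perfectField`).

Conversely, two `K`-algebra maps `f, g : E → R` give two base changes of each `ψ`, and their
quotient `g_*ψ ∘ (f_*ψ)⁻¹` is an `R`-point of the group (`comparisonPoint`). On the object whose `ψ`
is unipotent with entry `t`, this quotient is trivial only if `f t = g t`
(`comparisonPoint_eq_one`). A trivial group thus forces the two inclusions `E → E ⊗[K] E` to agree,
that is `t ⊗ 1 = 1 ⊗ t` for all `t`. Linear algebra over `K` then puts `t` in `K`
(`mem_range_algebraMap_of_tmul_comm`), so `E = K`. -/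

theorem linearMap_ext_one_tmul {M : Type*} [AddCommMonoid M] [Module R M]
    {g h : (R ⊗[K] V) →ₗ[R] M} (H : ∀ v : V, g (1 ⊗ₜ v) = h (1 ⊗ₜ v)) : g = h := by
  refine LinearMap.ext fun z => ?_
  induction z with
  | zero => simp
  | tmul s w =>
    have h1 : s ⊗ₜ[K] w = s • ((1 : R) ⊗ₜ[K] w) := by simp [TensorProduct.smul_tmul']
    rw [h1, map_smul, map_smul, H]
  | add x y hx hy => rw [map_add, map_add, hx, hy]

theorem rTensor_baseChange_algHom (f : E →ₐ[k] R) (b : W →ₗ[k] W') (x : E ⊗[k] W) :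
    f.toLinearMap.rTensor W' (b.baseChange E x) = b.baseChange R (f.toLinearMap.rTensor W x) := by
  induction x with
  | zero => simp
  | tmul a w => simp
  | add x y hx hy => simp only [map_add, hx, hy]

theorem rTensor_distribBaseChange_symm (f : E →ₐ[k] R) (x : E ⊗[k] W) (y : E ⊗[k] W') :
    f.toLinearMap.rTensor (W ⊗[k] W')
        ((AlgebraTensorModule.distribBaseChange k E W W').symm (x ⊗ₜ[E] y)) =
      (AlgebraTensorModule.distribBaseChange k R W W').symm
        (f.toLinearMap.rTensor W x ⊗ₜ[R] f.toLinearMap.rTensor W' y) := by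
  induction x with
  | zero => simp
  | add x x' hx hx' => simp only [TensorProduct.add_tmul, map_add, hx, hx']
  | tmul a w =>
    induction y with
    | zero => simp
    | add y y' hy hy' => simp only [TensorProduct.tmul_add, map_add, hy, hy']
    | tmul b w' => simp

variable [Algebra k K] [IsScalarTower k K E] [IsScalarTower k K R]

/-- The base change along `f : E → R` of an isomorphism `E ⊗ V ≃ E ⊗ W`, where `V` is defined over
`K` and `W` over `k`. -/
noncomputable def pushIso (f : E →ₐ[K] R) (ψ : (E ⊗[K] V) ≃ₗ[E] (E ⊗[k] W)) :
    (R ⊗[K] V) ≃ₗ[R] (R ⊗[k] W) :=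
  -- With `R` an `E`-algebra through `f`, both `R ⊗ V` and `R ⊗ W` are extensions of scalars from
  -- `E`.
  letI := f.toRingHom.toAlgebra
  haveI : IsScalarTower K E R := IsScalarTower.of_algebraMap_eq' f.comp_algebraMap.symm
  haveI : IsScalarTower k E R :=
    IsScalarTower.of_algebraMap_eq' (f.restrictScalars k).comp_algebraMap.symm
  (AlgebraTensorModule.cancelBaseChange K E R R V).symm ≪≫ₗ ψ.baseChange E R _ _ ≪≫ₗ
    AlgebraTensorModule.cancelBaseChange k E R R W

/-- The elements `1 ⊗ v` span, so this formula determines `pushIso`; the later identities are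
checked through it alone. -/
theorem pushIso_one_tmul (f : E →ₐ[K] R) (ψ : (E ⊗[K] V) ≃ₗ[E] (E ⊗[k] W)) (v : V) :
    pushIso f ψ (1 ⊗ₜ v) = (f.restrictScalars k).toLinearMap.rTensor W (ψ (1 ⊗ₜ v)) := by
  let _ := f.toRingHom.toAlgebra
  have : IsScalarTower K E R := IsScalarTower.of_algebraMap_eq' f.comp_algebraMap.symm
  have : IsScalarTower k E R :=
    IsScalarTower.of_algebraMap_eq' (f.restrictScalars k).comp_algebraMap.symm
  have h : ∀ y : E ⊗[k] W, AlgebraTensorModule.cancelBaseChange k E R R W (1 ⊗ₜ y) =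
      (f.restrictScalars k).toLinearMap.rTensor W y := fun y => by
    induction y with
    | zero => simp
    | tmul a w => simp [Algebra.smul_def]; rfl
    | add x y hx hy => rw [tmul_add, map_add, map_add, hx, hy]
  rw [← h]
  exact congrArg (fun z => AlgebraTensorModule.cancelBaseChange k E R R W
    (ψ.baseChange E R _ _ z)) (AlgebraTensorModule.cancelBaseChange_symm_tmul K E R (1 : R) v)

/-- The commuting square of a morphism survives base change; this gives naturality of the comparison
points. -/
theorem baseChange_pushIso (f : E →ₐ[K] R) (ψ : (E ⊗[K] V) ≃ₗ[E] (E ⊗[k] W))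
    (ψ' : (E ⊗[K] V') ≃ₗ[E] (E ⊗[k] W')) (a : V →ₗ[K] V') (b : W →ₗ[k] W')
    (h : ψ'.toLinearMap ∘ₗ a.baseChange E = b.baseChange E ∘ₗ ψ.toLinearMap) (x : R ⊗[K] V) :
    b.baseChange R (pushIso f ψ x) = pushIso f ψ' (a.baseChange R x) := by
  refine LinearMap.congr_fun (f := b.baseChange R ∘ₗ (pushIso f ψ).toLinearMap)
    (g := (pushIso f ψ').toLinearMap ∘ₗ a.baseChange R) (linearMap_ext_one_tmul fun v => ?_) x
  have hv : ψ' (1 ⊗ₜ a v) = b.baseChange E (ψ (1 ⊗ₜ v)) := by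
    simpa using LinearMap.congr_fun h (1 ⊗ₜ v)
  simp only [LinearMap.comp_apply, LinearEquiv.coe_coe, LinearMap.baseChange_tmul,
    pushIso_one_tmul, hv, rTensor_baseChange_algHom]

/-- The composite inside `pushIso` is the `ψ` of a tensor product of triples, so this gives the
tensor compatibility of comparison points. -/
theorem distribBaseChange_pushIso (f : E →ₐ[K] R) (ψ : (E ⊗[K] V) ≃ₗ[E] (E ⊗[k] W))
    (ψ' : (E ⊗[K] V') ≃ₗ[E] (E ⊗[k] W')) (x : R ⊗[K] (V ⊗[K] V')) :
    AlgebraTensorModule.distribBaseChange k R W W'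
      (pushIso f ((AlgebraTensorModule.distribBaseChange K E V V').trans
        ((TensorProduct.congr ψ ψ').trans
          (AlgebraTensorModule.distribBaseChange k E W W').symm)) x) =
      TensorProduct.congr (pushIso f ψ) (pushIso f ψ')
        (AlgebraTensorModule.distribBaseChange K R V V' x) := by
  refine LinearMap.congr_fun
    (f := (AlgebraTensorModule.distribBaseChange k R W W').toLinearMap ∘ₗ
      (pushIso f _).toLinearMap)
    (g := (TensorProduct.congr (pushIso f ψ) (pushIso f ψ')).toLinearMap ∘ₗ
      (AlgebraTensorModule.distribBaseChange K R V V').toLinearMap)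
    (linearMap_ext_one_tmul fun t => ?_) x
  induction t with
  | zero => simp
  | add t t' ht ht' => simp only [tmul_add, map_add, ht, ht']
  | tmul v v' =>
    simp only [LinearMap.comp_apply, LinearEquiv.coe_coe, pushIso_one_tmul, LinearEquiv.trans_apply,
      AlgebraTensorModule.distribBaseChange_tmul, congr_tmul, rTensor_distribBaseChange_symm,
      LinearEquiv.apply_symm_apply]

end

/-! ### Descent to `K`, and perfectness as surjectivity of `K → K^perf`. -/

/-- If `t ⊗ 1 = 1 ⊗ t` in `E ⊗[K] E`, then `t` lies in `K`. -/
theorem mem_range_algebraMap_of_tmul_comm {K E : Type*} [Field K] [Ring E] [Nontrivial E]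
    [Algebra K E] {t : E} (h : t ⊗ₜ[K] (1 : E) = 1 ⊗ₜ t) : t ∈ Set.range (algebraMap K E) := by
  by_contra ht
  have ht' : t ∉ (1 : Submodule K E) := fun h' => ht (Submodule.mem_one.1 h')
  -- A functional that kills `K · 1` but not `t`: applying `φ ⊗ id` to `h` gives `φ(t) · 1 = φ(1) ·
  -- t = 0`.
  obtain ⟨φ, hφt, hφ⟩ := Submodule.exists_le_ker_of_notMem ht'
  have h1 : φ 1 = 0 := hφ (Submodule.mem_one.2 ⟨1, map_one _⟩)
  have := congrArg (TensorProduct.lid K E ∘ φ.rTensor E) h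
  simp [h1, hφt] at this

theorem PerfectClosure.algebraMap_surjective_of_perfectField (K : Type*) [Field K] (p : ℕ)
    [Fact p.Prime] [CharP K p] [PerfectField K] :
    Function.Surjective (algebraMap K (PerfectClosure K p)) := by
  intro t
  have : PerfectRing K p := PerfectField.toPerfectRing p
  obtain ⟨⟨n, x⟩, rfl⟩ := PerfectClosure.mk_surjective K p t
  obtain ⟨y, rfl⟩ := ((bijective_frobenius K p).2.iterate n) x
  -- The element represented by `(n, x)` is the `p^n`-th root of `x = y^(p^n)`; both sides are
  -- compared after `n` Frobenius iterations.
  refine ⟨y, ((injective_frobenius (PerfectClosure K p) p).iterate n) ?_⟩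
  rw [PerfectClosure.iterate_frobenius_mk]
  exact (RingHom.map_iterate_frobenius (PerfectClosure.of K p) p y n).symm

theorem PerfectClosure.perfectField_of_algebraMap_surjective (K : Type*) [Field K] (p : ℕ)
    [Fact p.Prime] [CharP K p]
    (h : Function.Surjective (algebraMap K (PerfectClosure K p))) : PerfectField K := by
  have : PerfectRing K p := PerfectRing.ofSurjective K p fun x => by
    -- The `p`-th root of `x` exists in `K^perf`, and surjectivity brings it back to `K`.
    obtain ⟨t, ht⟩ := (bijective_frobenius (PerfectClosure K p) p).2 (algebraMap K _ x)
    obtain ⟨y, rfl⟩ := h t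
    exact ⟨y, (algebraMap K (PerfectClosure K p)).injective
      ((RingHom.map_frobenius _ p y).trans ht)⟩
  exact PerfectRing.toPerfectField K p

/-! ### Morphisms from the unit object, and unipotent triples of rank two. -/

namespace LocalTriple

variable {k : Type u} {K : Type v} [Field k] [Field K] [Algebra k K]
  {p : ℕ} [Fact p.Prime] [CharP K p]

instance : IsScalarTower k K (PerfectClosure K p) := IsScalarTower.of_algebraMap_eq' rfl

/-- The canonical isomorphism `K^perf ⊗ K ≃ K^perf ⊗ k` of the unit object. -/
noncomputable def unitIso (k : Type u) (K : Type v) [Field k] [Field K] [Algebra k K]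
    (p : ℕ) [Fact p.Prime] [CharP K p] :
    (PerfectClosure K p ⊗[K] K) ≃ₗ[PerfectClosure K p] (PerfectClosure K p ⊗[k] k) :=
  (TensorProduct.AlgebraTensorModule.rid K (PerfectClosure K p) (PerfectClosure K p)).trans
    (TensorProduct.AlgebraTensorModule.rid k (PerfectClosure K p) (PerfectClosure K p)).symm

theorem unitIso_one_tmul (c : K) :
    unitIso k K p (1 ⊗ₜ c) = algebraMap K (PerfectClosure K p) c ⊗ₜ 1 := by
  simp [unitIso, Algebra.smul_def]

/-- If `ψ` matches `1 ⊗ v` and `1 ⊗ w`, then `(v, w)` is a morphism from the unit object. -/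
noncomputable def homOfUnit (X : LocalTriple k K p) (v : X.V) (w : X.W)
    (h : X.ψ (1 ⊗ₜ v) = 1 ⊗ₜ w) : unit k K p ⟶ X where
  a := LinearMap.toSpanSingleton K X.V v
  b := LinearMap.toSpanSingleton k X.W w
  comm := by
    refine linearMap_ext_one_tmul (V := K) fun (c : K) => ?_
    have hl : (LinearMap.toSpanSingleton K X.V v).baseChange (PerfectClosure K p) (1 ⊗ₜ c) =
        algebraMap K (PerfectClosure K p) c • (1 ⊗ₜ v) := by
      rw [LinearMap.baseChange_tmul, LinearMap.toSpanSingleton_apply, algebraMap_smul,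
        TensorProduct.tmul_smul]
    have hr : (LinearMap.toSpanSingleton k X.W w).baseChange (PerfectClosure K p)
        (unitIso k K p (1 ⊗ₜ c)) = algebraMap K (PerfectClosure K p) c • (1 ⊗ₜ w) := by
      rw [unitIso_one_tmul, LinearMap.baseChange_tmul, LinearMap.toSpanSingleton_apply, one_smul,
        TensorProduct.smul_tmul', smul_eq_mul, mul_one]
    refine Eq.trans (congrArg X.ψ hl) (Eq.trans ?_ hr.symm)
    rw [map_smul, h]

/-- The isomorphism `K^perf ⊗ K² ≃ K^perf ⊗ k²` given by the unipotent matrix with entry `t`. -/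
noncomputable def shearIso (k : Type u) {K : Type v} [Field k] [Field K] [Algebra k K]
    {p : ℕ} [Fact p.Prime] [CharP K p] (t : PerfectClosure K p) :
    (PerfectClosure K p ⊗[K] (K × K)) ≃ₗ[PerfectClosure K p] (PerfectClosure K p ⊗[k] (k × k)) :=
  TensorProduct.prodRight K (PerfectClosure K p) (PerfectClosure K p) K K ≪≫ₗ
    -- The map `(x, y) ↦ (x, y + t x)` up to `unitIso`, invertible for every `t`.
    ((unitIso k K p).skewProd (unitIso k K p) (t • (unitIso k K p).toLinearMap)) ≪≫ₗ
    (TensorProduct.prodRight k (PerfectClosure K p) (PerfectClosure K p) k k).symm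

theorem shearIso_apply (t : PerfectClosure K p) :
    shearIso k t (1 ⊗ₜ (1, 0)) = 1 ⊗ₜ[k] ((1, 0) : k × k) + t ⊗ₜ[k] ((0, 1) : k × k) := by
  refine (LinearEquiv.symm_apply_eq
    (TensorProduct.prodRight k (PerfectClosure K p) (PerfectClosure K p) k k)).2 ?_
  simp [unitIso_one_tmul, TensorProduct.smul_tmul']

/-- The triple `(K², k², ψ)`, where `ψ` is the unipotent matrix with entry `t`. -/
noncomputable def shear (k : Type u) {K : Type v} [Field k] [Field K] [Algebra k K]
    {p : ℕ} [Fact p.Prime] [CharP K p] (t : PerfectClosure K p) : LocalTriple k K p where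
  V := K × K
  W := k × k
  ψ := shearIso k t

end LocalTriple

/-! ### Points of the group: construction, detection, and vanishing for perfect `K`. -/

section

variable {k : Type u} {K : Type v} [Field k] [Field K] [Algebra k K]
  {p : ℕ} [Fact p.Prime] [CharP K p] {R : Type w} [CommRing R] [Algebra k R] [Algebra K R]
  [IsScalarTower k K R]

/-- Two `K`-algebra maps `f, g : K^perf → R` give an `R`-point of `π^L(K/k)`: the automorphism of
`R ⊗ W` obtained by comparing the two base changes of `ψ`. -/
noncomputable def comparisonPoint (f g : PerfectClosure K p →ₐ[K] R) :
    localNoriPoints k K p R :=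
  ⟨fun X => (pushIso f X.ψ).symm ≪≫ₗ pushIso g X.ψ, by
    refine ⟨fun X Y h x => ?_, fun X Y z => ?_, ?_⟩
    -- Writing the argument as a value of the `f`-base change cancels the inverse.
    · obtain ⟨x, rfl⟩ := (pushIso f X.ψ).surjective x
      simp only [LinearEquiv.trans_apply, LinearEquiv.symm_apply_apply,
        baseChange_pushIso _ X.ψ Y.ψ h.a h.b h.comm]
    · obtain ⟨z, rfl⟩ := (pushIso f (X.tensor Y).ψ).surjective z
      simp only [LinearEquiv.trans_apply, LinearEquiv.symm_apply_apply]
      refine (distribBaseChange_pushIso g X.ψ Y.ψ z).trans ?_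
      refine Eq.trans ?_ (congrArg _ (distribBaseChange_pushIso f X.ψ Y.ψ z)).symm
      rw [TensorProduct.congr_trans]
      simp only [LinearEquiv.trans_apply, ← TensorProduct.congr_symm,
        LinearEquiv.symm_apply_apply]
    -- On the unit, `ψ` only involves scalars from `K`, where `f` and `g` agree.
    · have h : pushIso g (LocalTriple.unit k K p).ψ = pushIso f (LocalTriple.unit k K p).ψ := by
        refine LinearEquiv.toLinearMap_injective (linearMap_ext_one_tmul (V := K) fun (c : K) => ?_)
        refine (pushIso_one_tmul g _ c).trans (Eq.trans ?_ (pushIso_one_tmul f _ c).symm)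
        have hc : ∀ f : PerfectClosure K p →ₐ[K] R,
            (f.restrictScalars k).toLinearMap.rTensor k (LocalTriple.unitIso k K p (1 ⊗ₜ c)) =
              algebraMap K R c ⊗ₜ 1 := fun f => by
          simp [LocalTriple.unitIso_one_tmul]
        exact (hc g).trans (hc f).symm
      simp only [h, LinearEquiv.symm_trans_self]
      rfl⟩

/-- The entry `t` is a matrix coefficient of `shear k t`: the second coordinate of the image of `1 ⊗
(1, 0)` is `f t` or `g t`. -/
theorem comparisonPoint_eq_one {f g : PerfectClosure K p →ₐ[K] R}
    (h : comparisonPoint (k := k) f g = 1) : f = g := by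
  ext t
  have hX : ∀ X : LocalTriple k K p, (pushIso f X.ψ).symm ≪≫ₗ pushIso g X.ψ = 1 :=
    fun X => congrFun (congrArg Subtype.val h) X
  have h1 : pushIso g (LocalTriple.shearIso k t) (1 ⊗ₜ (1, 0)) =
      pushIso f (LocalTriple.shearIso k t) (1 ⊗ₜ (1, 0)) := by
    have h0 : (pushIso f (LocalTriple.shearIso k t)).symm ≪≫ₗ
        pushIso g (LocalTriple.shearIso k t) = 1 := hX (LocalTriple.shear k t)
    simpa using LinearEquiv.congr_fun h0 (pushIso f (LocalTriple.shearIso k t) (1 ⊗ₜ (1, 0)))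
  have h2 := (pushIso_one_tmul g _ _).symm.trans (h1.trans (pushIso_one_tmul f _ _))
  rw [LocalTriple.shearIso_apply] at h2
  have h3 := congrArg (fun z : R ⊗[k] (k × k) => TensorProduct.AlgebraTensorModule.rid k R R
    ((LinearMap.snd k k k).baseChange R z)) h2
  have key : ∀ f : PerfectClosure K p →ₐ[K] R, TensorProduct.AlgebraTensorModule.rid k R R
    ((LinearMap.snd k k k).baseChange R ((f.restrictScalars k).toLinearMap.rTensor (k × k)
      (1 ⊗ₜ ((1, 0) : k × k) + t ⊗ₜ ((0, 1) : k × k)))) = f t := fun f => by simp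
  exact (key f).symm.trans (h3.symm.trans (key g))

theorem localNoriPoints_eq_one_of_perfectField {S : Type w} [CommRing S] [Algebra k S]
    [PerfectField K] (l : localNoriPoints k K p S) : l = 1 := by
  obtain ⟨l, hn, -, hu⟩ := l
  refine Subtype.ext (funext fun X => LinearEquiv.toLinearMap_injective
    (linearMap_ext_one_tmul fun w => ?_))
  -- As `K → K^perf` is onto, each element of `K^perf ⊗ V` is some `1 ⊗ v`.
  obtain ⟨v, hv⟩ := TensorProduct.mk_surjective K X.V (PerfectClosure K p)
    (PerfectClosure.algebraMap_surjective_of_perfectField K p) (X.ψ.symm (1 ⊗ₜ w))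
  have h := hn _ _ (X.homOfUnit v w (by
    rw [← X.ψ.apply_symm_apply (1 ⊗ₜ w), ← hv]; rfl)) ((1 : S) ⊗ₜ[k] (1 : k))
  rw [hu] at h
  have hb : (X.homOfUnit v w (by
      rw [← X.ψ.apply_symm_apply (1 ⊗ₜ w), ← hv]; rfl)).b.baseChange S ((1 : S) ⊗ₜ[k] (1 : k)) =
      1 ⊗ₜ w := by
    refine (LinearMap.baseChange_tmul (f := LinearMap.toSpanSingleton k X.W w) _ _).trans ?_
    rw [LinearMap.toSpanSingleton_apply, one_smul]
  exact (hb.symm.trans (h.trans (congrArg _ hb))).symm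

end

/-! ### The equivalence. -/

theorem mainTheorem4 (p : ℕ) [Fact p.Prime] (k : Type u) (K : Type v) [Field k] [Field K]
    [Algebra k K] [CharP k p] [CharP K p] [PerfectField k] :
    PerfectField K ↔
      ∀ R : CommAlgCat.{max u v} k, Subsingleton ((localNoriGroup k K p).obj R) := by
  constructor
  · intro _ R
    exact ⟨fun a b => (localNoriPoints_eq_one_of_perfectField a).trans
      (localNoriPoints_eq_one_of_perfectField b).symm⟩
  · intro H
    refine PerfectClosure.perfectField_of_algebraMap_surjective K p fun t => ?_
    let E := PerfectClosure K p
    -- `E ⊗[K] E` lives in universe `v`; the lift places it in `max u v`, where the group functor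
    -- takes its test algebras.
    let e : E ⊗[K] E ≃ₐ[K] ULift.{u} (E ⊗[K] E) := ULift.algEquiv.symm
    let f : E →ₐ[K] ULift.{u} (E ⊗[K] E) :=
      e.toAlgHom.comp Algebra.TensorProduct.includeLeft
    let g : E →ₐ[K] ULift.{u} (E ⊗[K] E) :=
      e.toAlgHom.comp Algebra.TensorProduct.includeRight
    have : Subsingleton (localNoriPoints k K p (ULift.{u} (E ⊗[K] E))) :=
      H (CommAlgCat.of k (ULift.{u} (E ⊗[K] E)))
    have hfg : f = g := comparisonPoint_eq_one (k := k) (Subsingleton.elim _ _)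
    exact mem_range_algebraMap_of_tmul_comm (e.injective (DFunLike.congr_fun hfg t))
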